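/- Let $q$ be a real-valued $C^\infty$ function defined in a neighborhood of $[0,1]$. Let $\lambda_1<\lambda_2<\cdots$ be the eigenvalues of the Dirichlet Sturm–Liouville problem $$-y''+q\,y=\lambda\,y \ \text{ in } \left]0,1\right[,\qquad y(0)=y(1)=0,$$ and let $h_1,h_2,\dots$ be associated real eigenfunctions, orthonormal in $L^2(\left]0,1\right[)$. Let $S$ be a continuous function in $\left]0,1\right[$ and let $c\in\left]0,1\right[$ be a zero of $S$. Call $c$ a *node* of $S$ if, for any small enough $\varepsilon>0$, there exist points $x_\varepsilon^\pm$ with $c-\varepsilon<x_\varepsilon^-<c<x_\varepsilon^+<c+\varepsilon$ and $S(x_\varepsilon^-)\,S(x_\varepsilon^+)<0$. Call $c$ an *antinode* of $S$ if, for any small enough $\varepsilon>0$, $S$ does not change sign in $\left]c-\varepsilon,c+\varepsilon\right[$ (that is, $S\ge 0$ there or $S\le 0$ there) and vanishes identically neither in $\left]c-\varepsilon,c\right[$ nor in $\left]c,c+\varepsilon\right[$. **Proposition.** Let $n\ge 1$, let $b=(b_1,\dots,b_n)\in\mathbb{R}^n\setminus\{0\}$, and let $S_b=\sum_{j=1}^n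 b_j h_j$. Then the number $N_b$ of nodes of $S_b$ in $\left]0,1\right[$ and the number $A_b$ of antinodes of $S_b$ in $\left]0,1\right[$ are finite, and $$N_b+2A_b\le n-1.$$ -/

import Mathlib

open Set Filter Topology
open scoped ContDiff

/-- `y` is a (classical, real) eigenfunction of the Dirichlet problem
`-y'' + q y = μ y` in `]0,1[`, `y(0) = y(1) = 0`. -/
structure IsDirichletEigenfunction (q : ℝ → ℝ) (μ : ℝ) (y : ℝ → ℝ) : Prop where
  continuousOn : ContinuousOn y (Icc 0 1)
  contDiffOn : ContDiffOn ℝ 2 y (Ioo 0 1)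
  equation : ∀ x ∈ Ioo (0 : ℝ) 1, -deriv (deriv y) x + q x * y x = μ * y x
  left_boundary : y 0 = 0
  right_boundary : y 1 = 0
  nontrivial : ∃ x ∈ Ioo (0 : ℝ) 1, y x ≠ 0

/-- `μ` is an eigenvalue of the Dirichlet problem with potential `q` in `]0,1[`. -/
def IsDirichletEigenvalue (q : ℝ → ℝ) (μ : ℝ) : Prop :=
  ∃ y : ℝ → ℝ, IsDirichletEigenfunction q μ y

/-- `(ev 0, h 0), (ev 1, h 1), …` are the eigenpairs of the Dirichlet problem with potential `q`:
`ev` lists all the eigenvalues in increasing order, and the `h j` are associated eigenfunctions,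
orthonormal in `L²(]0,1[)`. The index starts at `0`, so `ev 0` is the first eigenvalue. -/
structure IsDirichletEigenpairs (q : ℝ → ℝ) (ev : ℕ → ℝ) (h : ℕ → ℝ → ℝ) : Prop where
  strictMono : StrictMono ev
  eigenvalue_iff : ∀ μ : ℝ, IsDirichletEigenvalue q μ ↔ ∃ j : ℕ, ev j = μ
  eigenfunction : ∀ j : ℕ, IsDirichletEigenfunction q (ev j) (h j)
  orthonormal : ∀ i j : ℕ, ∫ x in (0 : ℝ)..1, h i x * h j x = if i = j then 1 else 0

/-- The linear combination `S_b = b₁ h₁ + ⋯ + bₙ hₙ` of the first `n` functions. -/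
def linComb (h : ℕ → ℝ → ℝ) {n : ℕ} (b : Fin n → ℝ) (x : ℝ) : ℝ :=
  ∑ j : Fin n, b j * h j x

/-- `c` is a node of `S` in `]0,1[`: a zero of `S` such that, for every small enough `ε > 0`,
`S` takes values of opposite strict signs at some point of `]c-ε,c[` and some point
of `]c,c+ε[`. -/
def IsNode (S : ℝ → ℝ) (c : ℝ) : Prop :=
  c ∈ Ioo (0 : ℝ) 1 ∧ S c = 0 ∧
    ∀ᶠ ε in 𝓝[>] (0 : ℝ), ∃ xm ∈ Ioo (c - ε) c, ∃ xp ∈ Ioo c (c + ε), S xm * S xp < 0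

/-- `c` is an antinode of `S` in `]0,1[`: a zero of `S` such that, for every small enough `ε > 0`,
`S` does not change sign in `]c-ε,c+ε[`, and vanishes identically neither in `]c-ε,c[`
nor in `]c,c+ε[`. -/
def IsAntinode (S : ℝ → ℝ) (c : ℝ) : Prop :=
  c ∈ Ioo (0 : ℝ) 1 ∧ S c = 0 ∧
    ∀ᶠ ε in 𝓝[>] (0 : ℝ),
      ((∀ x ∈ Ioo (c - ε) (c + ε), 0 ≤ S x) ∨ (∀ x ∈ Ioo (c - ε) (c + ε), S x ≤ 0)) ∧
      (∃ x ∈ Ioo (c - ε) c, S x ≠ 0) ∧ (∃ x ∈ Ioo c (c + ε), S x ≠ 0)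

/-! This is Liouville's proof of Sturm's theorem. Take `μ` below the potential and all eigenvalues,
and a positive solution `V` for `μ`. With `S = ∑ b j * y j`, the function `S' V - S V'` is `V²`
times the derivative of `S / V`, and its own derivative is `-V * ∑ (λ j - μ) b j y j`. Two uses of
Rolle, with the zeros at `0` and `1` making up for the losses, show that the new combination has at
least as many zeros as `S`, double zeros counted twice (`exists_finset_zeros_of_double_zeros`).

Under iteration and rescaling, the combination tends to a multiple of the top eigenfunction `h p`
with `b p ≠ 0`. Its zeros are simple, so no zeros merge in the limit
(`exists_finset_zeros_of_tendsto`), and a Prüfer angle argument gives it at most `p ≤ n - 1` zeros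
(`card_zeros_le_of_isPruferAngle`). Antinodes are double zeros, hence their weight 2. -/

/-! ### Prüfer angles: existence, amplitude, dependence on `μ`. -/

/-- The right-hand side of the Prüfer equation `θ' = cos² θ + (μ - q) sin² θ`. -/
noncomputable def pruferField (q : ℝ → ℝ) (μ x θ : ℝ) : ℝ :=
  Real.cos θ ^ 2 + (μ - q x) * Real.sin θ ^ 2

/-- `θ` is a Prüfer angle for `-y'' + q y = μ y` on a neighborhood of `[0,1]`. -/
def IsPruferAngle (q : ℝ → ℝ) (μ : ℝ) (θ : ℝ → ℝ) : Prop :=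
  ∀ x ∈ Ioo (-1 : ℝ) 2, HasDerivAt θ (pruferField q μ x (θ x)) x

/-- `y` solves `-y'' + q y = μ y` on `[0,1]`, with derivative `z`. -/
def IsSolutionPair (q : ℝ → ℝ) (μ : ℝ) (y z : ℝ → ℝ) : Prop :=
  ∀ x ∈ Icc (0 : ℝ) 1, HasDerivAt y (z x) x ∧ HasDerivAt z ((q x - μ) * y x) x

theorem mem_Ioo_of_mem_unitInterval {x : ℝ} (hx : x ∈ Icc (0 : ℝ) 1) : x ∈ Ioo (-1 : ℝ) 2 :=
  ⟨by linarith [hx.1], by linarith [hx.2]⟩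

/-- A level that can only be crossed upward is a barrier. For strictness, touching `c` at `x > a`
with positive slope would put `θ` below `c` just before `x`. -/
theorem lt_of_deriv_pos_of_eq {θ θ' : ℝ → ℝ} {a b c : ℝ}
    (hθ : ∀ x ∈ Icc a b, HasDerivAt θ (θ' x) x) (hpos : ∀ x ∈ Icc a b, θ x = c → 0 < θ' x)
    (ha : c ≤ θ a) : ∀ x ∈ Ioc a b, c < θ x := by
  have hle : ∀ x ∈ Icc a b, c ≤ θ x := by
    have key := image_le_of_deriv_right_lt_deriv_boundary' (f := fun _ => c) (f' := fun _ => 0)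
      (B := θ) (B' := θ') (a := a) (b := b) continuousOn_const
      (fun x _ => hasDerivWithinAt_const _ _ _) ha
      (fun x hx => (hθ x hx).continuousAt.continuousWithinAt)
      (fun x hx => (hθ x (Ico_subset_Icc_self hx)).hasDerivWithinAt)
      (fun x hx h => hpos x (Ico_subset_Icc_self hx) h.symm)
    exact fun x hx => key hx
  intro x hx
  have hx' := Ioc_subset_Icc_self hx
  refine lt_of_le_of_ne (hle x hx') fun h => ?_
  have hd := hpos x hx' h.symm
  have hslope := (hasDerivAt_iff_tendsto_slope_left_right.mp (hθ x hx')).1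
  have h1 := hslope.eventually (lt_mem_nhds hd)
  have h2 : ∀ᶠ y in 𝓝[<] x, y ∈ Ioo a x := Ioo_mem_nhdsLT hx.1
  obtain ⟨y, hy1, hy2⟩ := (h1.and h2).exists
  have h3 := hle y ⟨hy2.1.le, hy2.2.le.trans hx.2⟩
  rw [slope_def_field] at hy1
  have h4 : (θ y - θ x) / (y - x) ≤ 0 :=
    div_nonpos_of_nonneg_of_nonpos (by linarith) (by linarith [hy2.2])
  linarith

theorem pruferField_eq (q : ℝ → ℝ) (μ x θ : ℝ) :
    pruferField q μ x θ = 1 + (μ - q x - 1) * Real.sin θ ^ 2 := by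
  rw [pruferField, Real.cos_sq']; ring

theorem abs_sin_sq_sub_le (a b : ℝ) : |Real.sin a ^ 2 - Real.sin b ^ 2| ≤ 2 * |a - b| := by
  rw [sq_sub_sq, abs_mul]
  have h1 : |Real.sin a + Real.sin b| ≤ 2 :=
    (abs_add_le _ _).trans (by linarith [Real.abs_sin_le_one a, Real.abs_sin_le_one b])
  exact mul_le_mul h1 (Real.abs_sin_sub_sin_le a b) (abs_nonneg _) zero_le_two

section

variable {q : ℝ → ℝ} {B : ℝ}

theorem abs_sub_sub_one_le (hB : ∀ x, |q x| ≤ B) (μ x : ℝ) : |μ - q x - 1| ≤ |μ| + B + 1 := by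
  have h1 := abs_sub (μ - q x) 1
  have h2 := abs_sub μ (q x)
  have := hB x
  simp only [abs_one] at h1
  linarith

theorem pruferField_lipschitz (hB : ∀ x, |q x| ≤ B) (μ x : ℝ) :
    LipschitzWith (2 * (|μ| + B + 1)).toNNReal (pruferField q μ x) := by
  have h0 := abs_sub_sub_one_le hB μ x
  have hn := (abs_nonneg _).trans h0
  refine LipschitzWith.of_dist_le_mul fun a b => ?_
  rw [Real.coe_toNNReal _ (by positivity), Real.dist_eq, Real.dist_eq, pruferField_eq,
    pruferField_eq]
  have : 1 + (μ - q x - 1) * Real.sin a ^ 2 - (1 + (μ - q x - 1) * Real.sin b ^ 2)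
      = (μ - q x - 1) * (Real.sin a ^ 2 - Real.sin b ^ 2) := by ring
  rw [this, abs_mul]
  calc _ ≤ (|μ| + B + 1) * (2 * |a - b|) :=
        mul_le_mul h0 (abs_sin_sq_sub_le a b) (abs_nonneg _) hn
    _ = _ := by ring

theorem abs_pruferField_le (hB : ∀ x, |q x| ≤ B) (μ x θ : ℝ) :
    |pruferField q μ x θ| ≤ 1 + (|μ| + B + 1) := by
  rw [pruferField_eq]
  have h0 := abs_sub_sub_one_le hB μ x
  refine (abs_add_le _ _).trans ?_
  rw [abs_one, abs_mul, abs_of_nonneg (sq_nonneg (Real.sin θ))]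
  have := mul_le_mul h0 (Real.sin_sq_le_one θ) (sq_nonneg _) ((abs_nonneg _).trans h0)
  linarith

theorem exists_isPruferAngle (hq : Continuous q) (hB : ∀ x, |q x| ≤ B) (μ α : ℝ) :
    ∃ θ, θ 0 = α ∧ IsPruferAngle q μ θ := by
  have hn := (abs_nonneg _).trans (abs_sub_sub_one_le hB μ 0)
  -- The field is bounded by `1 + (|μ| + B + 1)` and times stay within 2 of `0`, hence the radius.
  have hP : IsPicardLindelof (pruferField q μ) (tmin := -1) (tmax := 2) ⟨0, by norm_num⟩ α
      (2 * (1 + (|μ| + B + 1)).toNNReal) 0 (1 + (|μ| + B + 1)).toNNReal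
      (2 * (|μ| + B + 1)).toNNReal := by
    refine ⟨fun t _ => (pruferField_lipschitz hB μ t).lipschitzOnWith, fun x _ => ?_,
      fun t _ x _ => ?_, ?_⟩
    · unfold pruferField; fun_prop
    · rw [Real.coe_toNNReal _ (by positivity)]
      exact abs_pruferField_le hB μ t x
    · norm_num
      linarith
  obtain ⟨θ, h0, h⟩ := hP.exists_eq_forall_mem_Icc_hasDerivWithinAt₀
  exact ⟨θ, h0, fun x hx => (h x (Ioo_subset_Icc_self hx)).hasDerivAt (Icc_mem_nhds hx.1 hx.2)⟩

theorem IsPruferAngle.hasDerivAt {μ : ℝ} {θ : ℝ → ℝ} (h : IsPruferAngle q μ θ) {x : ℝ}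
    (hx : x ∈ Icc (0 : ℝ) 1) : HasDerivAt θ (pruferField q μ x (θ x)) x :=
  h x (mem_Ioo_of_mem_unitInterval hx)

/-- The amplitude of a Prüfer angle: `y = r sin θ` and `y' = r cos θ`. -/
theorem IsPruferAngle.exists_amplitude (hq : Continuous q) {μ : ℝ} {θ : ℝ → ℝ}
    (h : IsPruferAngle q μ θ) :
    ∃ r : ℝ → ℝ, r 0 = 1 ∧ (∀ x, 0 < r x) ∧
      IsSolutionPair q μ (fun x => r x * Real.sin (θ x)) (fun x => r x * Real.cos (θ x)) := by
  -- `g` is the logarithmic derivative of `r` forced by `y = r sin θ`, `y' = r cos θ`.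
  set g : ℝ → ℝ := fun t => (1 + q t - μ) * (Real.sin (θ t) * Real.cos (θ t)) with hg
  have hθc : ContinuousOn θ (Ioo (-1) 2) := fun x hx => (h x hx).continuousAt.continuousWithinAt
  have hgc : ContinuousOn g (Ioo (-1) 2) :=
    (by fun_prop : Continuous fun t => 1 + q t - μ).continuousOn.mul
      ((Real.continuous_sin.comp_continuousOn hθc).mul (Real.continuous_cos.comp_continuousOn hθc))
  refine ⟨fun x => Real.exp (∫ t in (0 : ℝ)..x, g t), by simp, fun x => Real.exp_pos _,
    fun x hx => ?_⟩
  have hx' := mem_Ioo_of_mem_unitInterval hx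
  have hint : HasDerivAt (fun x => ∫ t in (0 : ℝ)..x, g t) (g x) x := by
    refine intervalIntegral.integral_hasDerivAt_right ?_
      (hgc.stronglyMeasurableAtFilter isOpen_Ioo x hx') (hgc.continuousAt (isOpen_Ioo.mem_nhds hx'))
    refine (hgc.mono ?_).intervalIntegrable
    rw [uIcc_of_le hx.1]
    exact fun t ht => ⟨by linarith [ht.1], by linarith [ht.2, hx.2]⟩
  have hr := hint.exp
  have hθ := h x hx'
  have hsc := Real.sin_sq_add_cos_sq (θ x)
  constructor
  · refine (hr.mul hθ.sin).congr_deriv ?_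
    simp only [hg, pruferField]
    linear_combination (Real.exp (∫ t in (0 : ℝ)..x, g t) * Real.cos (θ x)) * hsc
  · refine (hr.mul hθ.cos).congr_deriv ?_
    simp only [hg, pruferField]
    linear_combination (Real.exp (∫ t in (0 : ℝ)..x, g t) * Real.sin (θ x) * (q x - μ)) * hsc

/-- The value at `1` of Prüfer angles with a common initial value depends continuously on `μ`. -/
theorem continuous_pruferAngle_one (hB : ∀ x, |q x| ≤ B) {α : ℝ} {Θ : ℝ → ℝ → ℝ}
    (h0 : ∀ μ, Θ μ 0 = α) (hΘ : ∀ μ, IsPruferAngle q μ (Θ μ)) : Continuous fun μ => Θ μ 1 := by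
  refine continuous_iff_continuousAt.mpr fun μ => ?_
  have hcont : ∀ ν, ContinuousOn (Θ ν) (Icc 0 1) := fun ν x hx =>
    ((hΘ ν).hasDerivAt hx).continuousAt.continuousWithinAt
  have hder : ∀ ν, ∀ x ∈ Ico (0 : ℝ) 1,
      HasDerivWithinAt (Θ ν) (pruferField q ν x (Θ ν x)) (Ici x) x := fun ν x hx =>
    ((hΘ ν).hasDerivAt (Ico_subset_Icc_self hx)).hasDerivWithinAt
  set K := (2 * (|μ| + B + 1)).toNNReal
  have hle : ∀ ν, dist (Θ ν 1) (Θ μ 1) ≤ gronwallBound 0 K (|ν - μ| + 0) (1 - 0) := by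
    intro ν
    -- The angle for `ν` solves the equation for `μ` up to an error `|ν - μ|`; Grönwall applies.
    refine dist_le_of_approx_trajectories_ODE (v := pruferField q μ)
      (fun t => pruferField_lipschitz hB μ t) (hcont ν) (hder ν) (fun t _ => ?_)
      (hcont μ) (hder μ) (fun t _ => (dist_self _).le) (by simp [h0]) 1 (by norm_num)
    rw [Real.dist_eq, pruferField_eq, pruferField_eq,
      show ∀ s : ℝ, 1 + (ν - q t - 1) * s - (1 + (μ - q t - 1) * s) = (ν - μ) * s by intro s; ring,
      abs_mul, abs_of_nonneg (sq_nonneg (Real.sin _))]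
    exact mul_le_of_le_one_right (abs_nonneg _) (Real.sin_sq_le_one _)
  refine tendsto_iff_dist_tendsto_zero.mpr
    (squeeze_zero (fun _ => dist_nonneg) hle ?_)
  have hc : Continuous fun ν => gronwallBound 0 K (|ν - μ| + 0) (1 - 0) := by
    by_cases hK : (K : ℝ) = 0
    · simp only [hK, gronwallBound_K0]; fun_prop
    · simp only [gronwallBound_of_K_ne_0 hK]; fun_prop
  have := hc.tendsto μ
  simpa [gronwallBound_ε0] using this

/-- Below the potential, Prüfer angles starting in `[0, π/4]` stay in `]0, π/4]`. -/
theorem IsPruferAngle.mem_Ioc_of_add_two_le {μ : ℝ} {θ : ℝ → ℝ} (h : IsPruferAngle q μ θ)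
    (hμ : ∀ x, μ + 2 ≤ q x) (h0 : 0 ≤ θ 0) (h1 : θ 0 ≤ Real.pi / 4) :
    ∀ x ∈ Ioc (0 : ℝ) 1, θ x ∈ Ioc 0 (Real.pi / 4) := by
  intro x hx
  refine ⟨lt_of_deriv_pos_of_eq (fun x hx => h.hasDerivAt hx) (fun x _ hθ => ?_) h0 x hx, ?_⟩
  · simp [pruferField, hθ]
  · have key := lt_of_deriv_pos_of_eq (θ := fun x => -θ x) (c := -(Real.pi / 4))
      (fun x hx => (h.hasDerivAt hx).neg) (fun x _ hθ => ?_) (neg_le_neg h1) x hx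
    · linarith
    -- At `π/4` the field is `(1 + μ - q) / 2 ≤ -1/2`, so this level is only crossed downward.
    · have hθ' : θ x = Real.pi / 4 := by linarith
      have := hμ x
      rw [hθ', pruferField, Real.cos_pi_div_four, Real.sin_pi_div_four, div_pow,
        Real.sq_sqrt zero_le_two]
      linarith

/-- For `μ` low enough there is a positive solution on `[0,1]`. -/
theorem exists_pos_solutionPair (hq : Continuous q) (hB : ∀ x, |q x| ≤ B) {μ : ℝ}
    (hμ : ∀ x, μ + 2 ≤ q x) :
    ∃ V W, IsSolutionPair q μ V W ∧ ∀ x ∈ Icc (0 : ℝ) 1, 0 < V x := by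
  obtain ⟨θ, h0, hθ⟩ := exists_isPruferAngle hq hB μ (Real.pi / 4)
  obtain ⟨r, -, hr, hs⟩ := hθ.exists_amplitude hq
  refine ⟨_, _, hs, fun x hx => mul_pos (hr x) ?_⟩
  have hpi := Real.pi_pos
  have hmem : θ x ∈ Ioc 0 (Real.pi / 4) := by
    rcases hx.1.eq_or_lt with rfl | hx0
    · rw [h0]; exact ⟨by positivity, le_rfl⟩
    · exact hθ.mem_Ioc_of_add_two_le hμ (by rw [h0]; positivity) h0.le x ⟨hx0, hx.2⟩
  exact Real.sin_pos_of_pos_of_lt_pi hmem.1 (by linarith [hmem.2])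

end

/-! ### Wronskians, eigenfunctions and the oscillation bound. -/

section

variable {q : ℝ → ℝ} {B : ℝ}

theorem IsDirichletEigenfunction.congr_potential {q' : ℝ → ℝ} {μ : ℝ} {y : ℝ → ℝ}
    (h : IsDirichletEigenfunction q μ y) (hqq : ∀ x ∈ Icc (0 : ℝ) 1, q' x = q x) :
    IsDirichletEigenfunction q' μ y :=
  { h with equation := fun x hx => by rw [hqq x (Ioo_subset_Icc_self hx)]; exact h.equation x hx }

theorem IsDirichletEigenfunction.hasDerivAt {μ : ℝ} {y : ℝ → ℝ}
    (h : IsDirichletEigenfunction q μ y) {x : ℝ} (hx : x ∈ Ioo (0 : ℝ) 1) :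
    HasDerivAt y (deriv y x) x ∧ HasDerivAt (deriv y) ((q x - μ) * y x) x := by
  have h2 := h.contDiffOn
  rw [show (2 : WithTop ℕ∞) = 1 + 1 from (one_add_one_eq_two).symm,
    contDiffOn_succ_iff_deriv_of_isOpen isOpen_Ioo] at h2
  have hnhds := isOpen_Ioo.mem_nhds hx
  refine ⟨((h2.1 x hx).differentiableAt hnhds).hasDerivAt, ?_⟩
  have h3 := (((h2.2.2.differentiableOn one_ne_zero) x hx).differentiableAt hnhds).hasDerivAt
  refine h3.congr_deriv ?_
  linarith [h.equation x hx]

theorem hasDerivAt_wronskian {q μ x : ℝ} {u u' v v' : ℝ → ℝ}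
    (hu : HasDerivAt u (u' x) x ∧ HasDerivAt u' ((q - μ) * u x) x)
    (hv : HasDerivAt v (v' x) x ∧ HasDerivAt v' ((q - μ) * v x) x) :
    HasDerivAt (fun x => u x * v' x - u' x * v x) 0 x :=
  ((hu.1.mul hv.2).sub (hu.2.mul hv.1)).congr_deriv (by ring)

theorem IsSolutionPair.wronskian_eq {μ : ℝ} {u u' v v' : ℝ → ℝ}
    (hu : IsSolutionPair q μ u u') (hv : IsSolutionPair q μ v v') :
    ∀ x ∈ Icc (0 : ℝ) 1, u x * v' x - u' x * v x = u 0 * v' 0 - u' 0 * v 0 := by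
  have hd := fun x hx => hasDerivAt_wronskian (hu x hx) (hv x hx)
  exact constant_of_has_deriv_right_zero
    (fun x hx => (hd x hx).continuousAt.continuousWithinAt)
    (fun x hx => (hd x (Ico_subset_Icc_self hx)).hasDerivWithinAt)

theorem IsDirichletEigenfunction.exists_wronskian_eq {μ : ℝ} {y v v' : ℝ → ℝ}
    (h : IsDirichletEigenfunction q μ y) (hv : IsSolutionPair q μ v v') :
    ∃ c, ∀ x ∈ Ioo (0 : ℝ) 1, y x * v' x - deriv y x * v x = c := by
  have hd := fun x (hx : x ∈ Ioo (0 : ℝ) 1) =>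
    hasDerivAt_wronskian (h.hasDerivAt hx) (hv x (Ioo_subset_Icc_self hx))
  exact ⟨_, fun x hx => isOpen_Ioo.is_const_of_deriv_eq_zero isPreconnected_Ioo
    (fun x hx => (hd x hx).differentiableAt.differentiableWithinAt)
    (fun x hx => (hd x hx).deriv) hx (⟨by norm_num, by norm_num⟩ : (1 / 2 : ℝ) ∈ Ioo (0 : ℝ) 1)⟩

/-- Every Dirichlet eigenfunction is a multiple of the solution vanishing at `0`. -/
theorem IsDirichletEigenfunction.exists_eq_const_mul (hq : Continuous q) (hB : ∀ x, |q x| ≤ B)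
    {μ : ℝ} {h y z : ℝ → ℝ} (hh : IsDirichletEigenfunction q μ h) (hy : IsSolutionPair q μ y z)
    (hy0 : y 0 = 0) (hz0 : z 0 = 1) :
    ∃ C, C ≠ 0 ∧ ∀ x ∈ Icc (0 : ℝ) 1, h x = C * y x := by
  obtain ⟨θ, hθ0, hθ⟩ := exists_isPruferAngle hq hB μ (Real.pi / 2)
  obtain ⟨r, hr0, -, hs⟩ := hθ.exists_amplitude hq
  set u : ℝ → ℝ := fun x => r x * Real.sin (θ x)
  set v : ℝ → ℝ := fun x => r x * Real.cos (θ x)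
  have hu0 : u 0 = 1 := by simp [u, hr0, hθ0]
  have hW : ∀ x ∈ Icc (0 : ℝ) 1, y x * v x - z x * u x = -1 := fun x hx => by
    rw [hy.wronskian_eq hs x hx, hy0, hz0, hu0]; ring
  obtain ⟨c, hc⟩ := hh.exists_wronskian_eq hy
  obtain ⟨d, hd⟩ := hh.exists_wronskian_eq hs
  -- Cramer's rule in the basis `u`, `y`, on the open interval; continuity of `h` carries it to the
  -- endpoints, where `deriv h` is not controlled.
  have hEq : EqOn h (fun x => c * u x - d * y x) (Icc 0 1) := by
    refine EqOn.of_subset_closure (s := Ioo 0 1) (fun x hx => ?_) hh.continuousOn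
      (fun x hx => ?_) Ioo_subset_Icc_self (closure_Ioo (zero_ne_one)).ge
    · have h1 := hW x (Ioo_subset_Icc_self hx)
      show h x = c * u x - d * y x
      rw [← hc x hx, ← hd x hx]
      linear_combination (h x) * h1
    · exact (((hs x hx).1.const_mul c).sub
        ((hy x hx).1.const_mul d)).continuousAt.continuousWithinAt
  have hc0 : c = 0 := by
    have := hEq (left_mem_Icc.mpr zero_le_one)
    simpa [hh.left_boundary, hu0, hy0] using this.symm
  have hEq' : ∀ x ∈ Icc (0 : ℝ) 1, h x = -d * y x := fun x hx => by
    have := hEq hx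
    simp only [hc0] at this
    linarith
  refine ⟨-d, fun h0 => ?_, hEq'⟩
  obtain ⟨x, hx, hne⟩ := hh.nontrivial
  exact hne (by rw [hEq' x (Ioo_subset_Icc_self hx), h0, zero_mul])

theorem IsSolutionPair.isDirichletEigenfunction (hq : Continuous q) {μ : ℝ} {y z : ℝ → ℝ}
    (hy : IsSolutionPair q μ y z) (h0 : y 0 = 0) (h1 : y 1 = 0)
    (hne : ∃ x ∈ Ioo (0 : ℝ) 1, y x ≠ 0) : IsDirichletEigenfunction q μ y := by
  have hyd : ∀ x ∈ Ioo (0 : ℝ) 1, deriv y x = z x := fun x hx =>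
    (hy x (Ioo_subset_Icc_self hx)).1.deriv
  have hzd : ∀ x ∈ Ioo (0 : ℝ) 1, deriv z x = (q x - μ) * y x := fun x hx =>
    (hy x (Ioo_subset_Icc_self hx)).2.deriv
  have hdy : DifferentiableOn ℝ y (Ioo 0 1) := fun x hx =>
    (hy x (Ioo_subset_Icc_self hx)).1.differentiableAt.differentiableWithinAt
  have hdz : DifferentiableOn ℝ z (Ioo 0 1) := fun x hx =>
    (hy x (Ioo_subset_Icc_self hx)).2.differentiableAt.differentiableWithinAt
  refine ⟨fun x hx => (hy x hx).1.continuousAt.continuousWithinAt, ?_, fun x hx => ?_, h0, h1, hne⟩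
  · rw [show (2 : WithTop ℕ∞) = 1 + 1 from (one_add_one_eq_two).symm,
      contDiffOn_succ_iff_deriv_of_isOpen isOpen_Ioo]
    refine ⟨hdy, by simp, ContDiffOn.congr ?_ hyd⟩
    rw [show (1 : WithTop ℕ∞) = 0 + 1 from (zero_add 1).symm,
      contDiffOn_succ_iff_deriv_of_isOpen isOpen_Ioo]
    refine ⟨hdz, by simp, contDiffOn_zero.mpr (ContinuousOn.congr ?_ hzd)⟩
    exact (by fun_prop : Continuous fun x => q x - μ).continuousOn.mul hdy.continuousOn
  · have : deriv (deriv y) x = deriv z x :=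
      Filter.EventuallyEq.deriv_eq ((isOpen_Ioo.mem_nhds hx : Ioo (0:ℝ) 1 ∈ 𝓝 x) |>
        fun hm => Filter.eventually_of_mem hm hyd)
    rw [this, hzd x hx]; ring

/-- At a multiple of `π` the field equals 1, so each such level is met at most once, going upward.
-/
theorem IsPruferAngle.lt_of_sin_eq_zero {μ : ℝ} {θ : ℝ → ℝ} (h : IsPruferAngle q μ θ) {x y : ℝ}
    (hx : 0 ≤ x) (hxy : x < y) (hy : y ≤ 1) (hs : Real.sin (θ x) = 0) : θ x < θ y := by
  refine lt_of_deriv_pos_of_eq (a := x) (b := 1)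
    (fun t ht => h.hasDerivAt ⟨hx.trans ht.1, ht.2⟩) (fun t _ hθ => ?_) le_rfl y ⟨hxy, hy⟩
  have hc := Real.sin_sq_add_cos_sq (θ x)
  rw [hs] at hc
  rw [hθ, pruferField, hs]
  linarith

/-- If the Prüfer angle starts at `0` and ends at a multiple of `π`, then `μ` is an eigenvalue. -/
theorem IsPruferAngle.isDirichletEigenvalue (hq : Continuous q) {μ : ℝ} {θ : ℝ → ℝ}
    (h : IsPruferAngle q μ θ) (h0 : θ 0 = 0) (h1 : Real.sin (θ 1) = 0) :
    IsDirichletEigenvalue q μ := by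
  obtain ⟨r, -, hr, hs⟩ := h.exists_amplitude hq
  refine ⟨_, hs.isDirichletEigenfunction hq (by simp [h0]) (by simp [h1]) ?_⟩
  by_contra! hall
  have hsin : ∀ x ∈ Ioo (0 : ℝ) 1, Real.sin (θ x) = 0 := fun x hx =>
    (mul_eq_zero.mp (hall x hx)).resolve_left (hr x).ne'
  have hx : (1 / 2 : ℝ) ∈ Ioo (0 : ℝ) 1 := by constructor <;> norm_num
  have hd := (h.hasDerivAt (Ioo_subset_Icc_self hx)).sin
  have hz : HasDerivAt (fun x => Real.sin (θ x)) 0 (1 / 2) :=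
    (hasDerivAt_const (1 / 2 : ℝ) (0 : ℝ)).congr_of_eventuallyEq
      (Filter.eventually_of_mem (isOpen_Ioo.mem_nhds hx) hsin)
  have := hd.unique hz
  have hc := Real.sin_sq_add_cos_sq (θ (1 / 2))
  rw [pruferField, hsin _ hx] at this
  rw [hsin _ hx] at hc
  have hcos : Real.cos (θ (1 / 2)) ^ 2 = 1 := by linarith
  rw [hcos] at this
  norm_num at this
  rw [this] at hcos
  norm_num at hcos

/-- Oscillation bound: the solution attached to the eigenvalue of index `p` has at most `p` zeros
in `]0,1[`. -/
theorem card_zeros_le_of_isPruferAngle (hq : Continuous q) (hB : ∀ x, |q x| ≤ B) {ev : ℕ → ℝ}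
    (hmono : StrictMono ev) (hev : ∀ μ, IsDirichletEigenvalue q μ → ∃ j, ev j = μ)
    {Θ : ℝ → ℝ → ℝ} (h0 : ∀ μ, Θ μ 0 = 0) (hΘ : ∀ μ, IsPruferAngle q μ (Θ μ)) (p : ℕ)
    (s : Finset ℝ) (hs : ∀ x ∈ s, x ∈ Ioo (0 : ℝ) 1 ∧ Real.sin (Θ (ev p) x) = 0) :
    s.card ≤ p := by
  have hlt : ∀ x ∈ s, Θ (ev p) x < Θ (ev p) 1 := fun x hx =>
    (hΘ _).lt_of_sin_eq_zero (hs x hx).1.1.le (hs x hx).1.2 le_rfl (hs x hx).2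
  -- The level `Θ (ev p) x` is a positive multiple of `π` below `Θ (ev p) 1`. As `Θ ν 1 ≤ π/4` for
  -- low `ν`, some `τ < ev p` has `Θ τ 1` at this level, so `τ` is an eigenvalue. Distinct zeros
  -- have distinct levels, hence distinct indices.
  have hidx : ∀ x ∈ s, ∃ i < p, Θ (ev i) 1 = Θ (ev p) x := by
    intro x hx
    obtain ⟨hx01, hsx⟩ := hs x hx
    set ν := min (ev p) (-B - 2)
    have hpi := Real.pi_pos
    have hlow : Θ ν 1 ≤ Real.pi / 4 := by
      refine ((hΘ ν).mem_Ioc_of_add_two_le (fun t => ?_) (h0 ν).ge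
        (by rw [h0]; positivity) 1 ⟨zero_lt_one, le_rfl⟩).2
      linarith [min_le_right (ev p) (-B - 2), neg_le_of_abs_le (hB t)]
    have hpos : 0 < Θ (ev p) x := by
      have := (hΘ (ev p)).lt_of_sin_eq_zero le_rfl hx01.1 hx01.2.le (by simp [h0])
      rwa [h0] at this
    have hge : Real.pi / 4 ≤ Θ (ev p) x := by
      by_contra! hc
      exact (Real.sin_pos_of_pos_of_lt_pi hpos (by linarith)).ne' hsx
    obtain ⟨τ, hτ, hτe⟩ := intermediate_value_Icc (min_le_left (ev p) (-B - 2))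
      (continuous_pruferAngle_one hB h0 hΘ).continuousOn
      (⟨hlow.trans hge, (hlt x hx).le⟩ : Θ (ev p) x ∈ Icc (Θ ν 1) (Θ (ev p) 1))
    simp only at hτe
    obtain ⟨i, rfl⟩ := hev τ ((hΘ τ).isDirichletEigenvalue hq (h0 τ) (by rw [hτe, hsx]))
    refine ⟨i, hmono.lt_iff_lt.mp (lt_of_le_of_ne hτ.2 fun h => ?_), hτe⟩
    rw [h] at hτe
    exact (hlt x hx).ne' hτe
  choose! f hf hfe using hidx
  rw [← Finset.card_range p]
  refine Finset.card_le_card_of_injOn f (fun x hx => Finset.mem_coe.mpr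
    (Finset.mem_range.mpr (hf x hx))) fun x hx y hy hxy => ?_
  have heq : Θ (ev p) x = Θ (ev p) y := by rw [← hfe x hx, ← hfe y hy, hxy]
  obtain ⟨hx1, hx2⟩ := hs x hx
  obtain ⟨hy1, hy2⟩ := hs y hy
  rcases lt_trichotomy x y with h | h | h
  · exact absurd heq ((hΘ _).lt_of_sin_eq_zero hx1.1.le h hy1.2.le hx2).ne
  · exact h
  · exact absurd heq ((hΘ _).lt_of_sin_eq_zero hy1.1.le h hx1.2.le hy2).ne'

end

/-! ### Rolle counting and Liouville's step. -/

/-- Rolle between consecutive points of `s`. Disjointness from `s` later lets double zeros be added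
without being counted twice. -/
theorem exists_finset_deriv_eq_zero {f f' : ℝ → ℝ} {a b : ℝ}
    (hf : ∀ x ∈ Icc a b, HasDerivAt f (f' x) x) (s : Finset ℝ)
    (hs : ∀ x ∈ s, x ∈ Icc a b ∧ f x = 0) :
    ∃ t : Finset ℝ, s.card ≤ t.card + 1 ∧ Disjoint s t ∧ ∀ x ∈ t, x ∈ Ioo a b ∧ f' x = 0 := by
  rcases hm : s.card with _ | m
  · exact ⟨∅, by simp⟩
  set e := s.orderEmbOfFin hm
  have hmem : ∀ i, e i ∈ s := s.orderEmbOfFin_mem hm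
  have hz : ∀ i : Fin m, ∃ z ∈ Ioo (e i.castSucc) (e i.succ), f' z = 0 := by
    intro i
    have hsub : Icc (e i.castSucc) (e i.succ) ⊆ Icc a b :=
      Icc_subset_Icc (hs _ (hmem _)).1.1 (hs _ (hmem _)).1.2
    refine exists_hasDerivAt_eq_zero (e.strictMono i.castSucc_lt_succ)
      (fun x hx => (hf x (hsub hx)).continuousAt.continuousWithinAt)
      ((hs _ (hmem _)).2.trans (hs _ (hmem _)).2.symm)
      fun x hx => hf x (hsub (Ioo_subset_Icc_self hx))
  choose z hz hz0 using hz
  have hzm : StrictMono z := fun i j hij =>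
    (hz i).2.trans_le ((e.monotone (Fin.succ_le_castSucc_iff.mpr hij)).trans (hz j).1.le)
  refine ⟨Finset.univ.image z, ?_, ?_, ?_⟩
  · rw [Finset.card_image_of_injective _ hzm.injective, Finset.card_fin]
  · rw [Finset.disjoint_right]
    simp only [Finset.mem_image, Finset.mem_univ, true_and, forall_exists_index]
    rintro _ i rfl hi
    obtain ⟨k, hk⟩ : z i ∈ Set.range e := by
      rw [s.range_orderEmbOfFin hm]; exact hi
    have h1 := (hz i).1
    have h2 := (hz i).2
    rw [← hk, e.lt_iff_lt] at h1 h2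
    simp only [Fin.lt_def, Fin.val_castSucc, Fin.val_succ] at h1 h2
    omega
  · simp only [Finset.mem_image, Finset.mem_univ, true_and, forall_exists_index]
    rintro _ i rfl
    exact ⟨⟨(hs _ (hmem _)).1.1.trans_lt (hz i).1, (hz i).2.trans_le (hs _ (hmem _)).1.2⟩, hz0 i⟩

section

variable {q : ℝ → ℝ} {n : ℕ} {lam : Fin n → ℝ} {y z : Fin n → ℝ → ℝ}

theorem hasDerivAt_sum_const_mul (hyz : ∀ j, IsSolutionPair q (lam j) (y j) (z j)) (b : Fin n → ℝ)
    {x : ℝ} (hx : x ∈ Icc (0 : ℝ) 1) :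
    HasDerivAt (fun x => ∑ j, b j * y j x) (∑ j, b j * z j x) x :=
  HasDerivAt.fun_sum fun j _ => ((hyz j) x hx).1.const_mul _

/-- Liouville's step: replacing `b j` by `(λ j - μ) b j` does not lose zeros, and double zeros
produce additional ones. -/
theorem exists_finset_zeros_of_double_zeros {μ : ℝ} {V W : ℝ → ℝ} (hV : IsSolutionPair q μ V W)
    (hpos : ∀ x ∈ Icc (0 : ℝ) 1, 0 < V x) (hyz : ∀ j, IsSolutionPair q (lam j) (y j) (z j))
    (hy0 : ∀ j, y j 0 = 0) (hy1 : ∀ j, y j 1 = 0) (b : Fin n → ℝ) (s d : Finset ℝ) (hds : d ⊆ s)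
    (hs : ∀ x ∈ s, x ∈ Ioo (0 : ℝ) 1 ∧ ∑ j, b j * y j x = 0)
    (hd : ∀ x ∈ d, ∑ j, b j * z j x = 0) :
    ∃ t : Finset ℝ, s.card + d.card ≤ t.card ∧
      ∀ x ∈ t, x ∈ Ioo (0 : ℝ) 1 ∧ ∑ j, ((lam j - μ) * b j) * y j x = 0 := by
  classical
  set S : ℝ → ℝ := fun x => ∑ j, b j * y j x with hS
  set S' : ℝ → ℝ := fun x => ∑ j, b j * z j x with hS'
  have hSd : ∀ x ∈ Icc (0 : ℝ) 1, HasDerivAt S (S' x) x := fun x hx =>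
    hasDerivAt_sum_const_mul hyz b hx
  have hSd' : ∀ x ∈ Icc (0 : ℝ) 1, HasDerivAt S' (∑ j, b j * ((q x - lam j) * y j x)) x :=
    fun x hx => HasDerivAt.fun_sum fun j _ => ((hyz j) x hx).2.const_mul _
  have hquot : ∀ x ∈ Icc (0 : ℝ) 1,
      HasDerivAt (fun x => S x / V x) ((S' x * V x - S x * W x) / V x ^ 2) x := fun x hx =>
    (hSd x hx).fun_div (hV x hx).1 (hpos x hx).ne'
  -- The endpoints are two further zeros, one for each of the two uses of Rolle.
  obtain ⟨t, htc, hdisj, ht⟩ := exists_finset_deriv_eq_zero hquot (insert 0 (insert 1 s))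
    (by
      intro x hx
      simp only [Finset.mem_insert] at hx
      rcases hx with rfl | rfl | hx
      · simp [hS, hy0]
      · simp [hS, hy1]
      · exact ⟨Ioo_subset_Icc_self (hs x hx).1, by simp only [hS, (hs x hx).2, zero_div]⟩)
  have h1s : (1 : ℝ) ∉ s := fun h => lt_irrefl _ (hs 1 h).1.2
  have h0s : (0 : ℝ) ∉ insert 1 s := by
    rw [Finset.mem_insert, not_or]
    exact ⟨zero_ne_one, fun h => lt_irrefl _ (hs 0 h).1.1⟩
  rw [Finset.card_insert_of_notMem h0s, Finset.card_insert_of_notMem h1s] at htc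
  have htd : Disjoint t d := by
    refine (Finset.disjoint_of_subset_left ?_ hdisj).symm
    exact hds.trans ((Finset.subset_insert _ _).trans (Finset.subset_insert _ _))
  have hg : ∀ x ∈ Icc (0 : ℝ) 1, HasDerivAt (fun x => S' x * V x - S x * W x)
      (-V x * ∑ j, ((lam j - μ) * b j) * y j x) x := by
    intro x hx
    refine (((hSd' x hx).mul (hV x hx).1).sub ((hSd x hx).mul (hV x hx).2)).congr_deriv ?_
    have : ∑ j, b j * ((q x - lam j) * y j x)
        = (q x - μ) * S x - ∑ j, ((lam j - μ) * b j) * y j x := by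
      rw [hS, Finset.mul_sum, ← Finset.sum_sub_distrib]
      exact Finset.sum_congr rfl fun j _ => by ring
    rw [this]; ring
  -- At points of `d` both `S` and `S'` vanish, so they are zeros of `S' V - S W` beyond those in
  -- `t`.
  obtain ⟨t', htc', -, ht'⟩ := exists_finset_deriv_eq_zero hg (t ∪ d)
    (by
      intro x hx
      rcases Finset.mem_union.mp hx with hx | hx
      · obtain ⟨h1, h2⟩ := ht x hx
        have h3 := (hpos x (Ioo_subset_Icc_self h1)).ne'
        exact ⟨Ioo_subset_Icc_self h1, (div_eq_zero_iff.mp h2).resolve_right (pow_ne_zero 2 h3)⟩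
      · obtain ⟨h1, h2⟩ := hs x (hds hx)
        exact ⟨Ioo_subset_Icc_self h1, by simp only [hS, hS', h2, hd x hx]; ring⟩)
  rw [Finset.card_union_of_disjoint htd] at htc'
  refine ⟨t', by omega, fun x hx => ?_⟩
  obtain ⟨h1, h2⟩ := ht' x hx
  have h3 := hpos x (Ioo_subset_Icc_self h1)
  exact ⟨h1, (mul_eq_zero.mp h2).resolve_left (neg_ne_zero.mpr h3.ne')⟩

theorem exists_finset_zeros_iterate {μ : ℝ} {V W : ℝ → ℝ} (hV : IsSolutionPair q μ V W)
    (hpos : ∀ x ∈ Icc (0 : ℝ) 1, 0 < V x) (hyz : ∀ j, IsSolutionPair q (lam j) (y j) (z j))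
    (hy0 : ∀ j, y j 0 = 0) (hy1 : ∀ j, y j 1 = 0) (b : Fin n → ℝ) (s : Finset ℝ)
    (hs : ∀ x ∈ s, x ∈ Ioo (0 : ℝ) 1 ∧ ∑ j, b j * y j x = 0) (k : ℕ) :
    ∃ t : Finset ℝ, s.card ≤ t.card ∧
      ∀ x ∈ t, x ∈ Ioo (0 : ℝ) 1 ∧ ∑ j, ((lam j - μ) ^ k * b j) * y j x = 0 := by
  induction k with
  | zero => exact ⟨s, le_rfl, by simpa using hs⟩
  | succ k ih =>
    obtain ⟨t, htc, ht⟩ := ih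
    obtain ⟨t', htc', ht'⟩ := exists_finset_zeros_of_double_zeros hV hpos hyz hy0 hy1
      (fun j => (lam j - μ) ^ k * b j) t ∅ (Finset.empty_subset _) ht (by simp)
    refine ⟨t', htc.trans (by simpa using htc'), fun x hx => ?_⟩
    obtain ⟨h1, h2⟩ := ht' x hx
    exact ⟨h1, by simpa only [pow_succ', mul_assoc] using h2⟩

/-! ### Passage to the limit of the coefficients. -/

/-- Zeros in `]0,1[` persist in the limit of the coefficients, provided that the limit combination
has only simple zeros on `[0,1]`. -/
theorem exists_finset_zeros_of_tendsto (hyz : ∀ j, IsSolutionPair q (lam j) (y j) (z j))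
    (hy0 : ∀ j, y j 0 = 0) (hy1 : ∀ j, y j 1 = 0) {c : ℕ → Fin n → ℝ} {a : Fin n → ℝ}
    (hc : Tendsto c atTop (𝓝 a)) {N : ℕ}
    (hzeros : ∀ k, ∃ t : Finset ℝ, N ≤ t.card ∧
      ∀ x ∈ t, x ∈ Ioo (0 : ℝ) 1 ∧ ∑ j, c k j * y j x = 0)
    (hsimple : ∀ x ∈ Icc (0 : ℝ) 1, ∑ j, a j * y j x = 0 → ∑ j, a j * z j x ≠ 0) :
    ∃ t : Finset ℝ, N ≤ t.card ∧ ∀ x ∈ t, x ∈ Ioo (0 : ℝ) 1 ∧ ∑ j, a j * y j x = 0 := by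
  classical
  -- Adjoining `0` and `1` treats a zero escaping to the boundary as a collision with an endpoint.
  have htuple : ∀ k, ∃ x : Fin (N + 2) → ℝ, StrictMono x ∧
      ∀ i, x i ∈ Icc (0 : ℝ) 1 ∧ ∑ j, c k j * y j (x i) = 0 := by
    intro k
    obtain ⟨t, htc, ht⟩ := hzeros k
    have h1t : (1 : ℝ) ∉ t := fun h => lt_irrefl _ (ht 1 h).1.2
    have h0t : (0 : ℝ) ∉ insert 1 t := by
      rw [Finset.mem_insert, not_or]
      exact ⟨zero_ne_one, fun h => lt_irrefl _ (ht 0 h).1.1⟩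
    have hcard : N + 2 ≤ (insert 0 (insert 1 t)).card := by
      rw [Finset.card_insert_of_notMem h0t, Finset.card_insert_of_notMem h1t]; omega
    refine ⟨_, (Finset.orderEmbOfCardLe _ hcard).strictMono, fun i => ?_⟩
    have hm := Finset.orderEmbOfCardLe_mem (insert 0 (insert 1 t)) hcard i
    simp only [Finset.mem_insert] at hm
    rcases hm with h | h | h
    · simp [h, hy0]
    · simp [h, hy1]
    · exact ⟨Ioo_subset_Icc_self (ht _ h).1, (ht _ h).2⟩
  choose x hxm hx using htuple
  obtain ⟨X, hX, φ, hφ, hlim⟩ := (isCompact_univ_pi fun _ : Fin (N + 2) =>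
    isCompact_Icc (a := (0 : ℝ)) (b := 1)).tendsto_subseq
    (x := x) (fun k => fun i _ => (hx k i).1)
  have hXi : ∀ i, X i ∈ Icc (0 : ℝ) 1 := fun i => hX i trivial
  have hlimi : ∀ i, Tendsto (fun k => x (φ k) i) atTop (𝓝 (X i)) := fun i =>
    (tendsto_pi_nhds.mp hlim) i
  have hcj : ∀ j, Tendsto (fun k => c (φ k) j) atTop (𝓝 (a j)) := fun j =>
    ((tendsto_pi_nhds.mp hc) j).comp hφ.tendsto_atTop
  have hpass : ∀ (u : Fin n → ℝ → ℝ) (w : ℕ → ℝ) (w₀ : ℝ), (∀ j, ContinuousAt (u j) w₀) →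
      Tendsto w atTop (𝓝 w₀) → (∀ k, ∑ j, c (φ k) j * u j (w k) = 0) → ∑ j, a j * u j w₀ = 0 :=
    fun u w w₀ hu hw h0 => tendsto_nhds_unique
      (tendsto_finsetSum _ fun j _ => (hcj j).mul ((hu j).tendsto.comp hw))
      (by simpa only [Function.comp_apply, h0] using tendsto_const_nhds)
  have hzero : ∀ i, ∑ j, a j * y j (X i) = 0 := fun i =>
    hpass y _ _ (fun j => (hyz j _ (hXi i)).1.continuousAt) (hlimi i) fun k => (hx (φ k) i).2
  -- If two zeros merged, the Rolle zeros of the derivative between them would converge to the same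
  -- point, giving a double zero of the limit.
  have hne : ∀ i j, i < j → X i ≠ X j := by
    intro i j hij heq
    have hw : ∀ k, ∃ w ∈ Ioo (x (φ k) i) (x (φ k) j), ∑ l, c (φ k) l * z l w = 0 := by
      intro k
      have hsub : Icc (x (φ k) i) (x (φ k) j) ⊆ Icc (0 : ℝ) 1 :=
        Icc_subset_Icc (hx _ i).1.1 (hx _ j).1.2
      exact exists_hasDerivAt_eq_zero (hxm (φ k) hij)
        (fun t ht => (hasDerivAt_sum_const_mul hyz (c (φ k))
          (hsub ht)).continuousAt.continuousWithinAt)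
        ((hx _ i).2.trans (hx _ j).2.symm)
        fun t ht => hasDerivAt_sum_const_mul hyz (c (φ k)) (hsub (Ioo_subset_Icc_self ht))
    choose w hw hw0 using hw
    have hwlim : Tendsto w atTop (𝓝 (X i)) :=
      tendsto_of_tendsto_of_tendsto_of_le_of_le (hlimi i) (heq ▸ hlimi j)
        (fun k => (hw k).1.le) (fun k => (hw k).2.le)
    exact hsimple _ (hXi i) (hzero i)
      (hpass z w _ (fun l => (hyz l _ (hXi i)).2.continuousAt) hwlim hw0)
  have hinj : Function.Injective X := fun i j h => by
    rcases lt_trichotomy i j with hij | hij | hij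
    · exact absurd h (hne i j hij)
    · exact hij
    · exact absurd h.symm (hne j i hij)
  refine ⟨Finset.univ.image X \ {0, 1}, ?_, fun t ht => ?_⟩
  · have h1 := Finset.le_card_sdiff ({0, 1} : Finset ℝ) (Finset.univ.image X)
    rw [Finset.card_image_of_injective _ hinj, Finset.card_fin] at h1
    have h2 : ({0, 1} : Finset ℝ).card ≤ 2 := Finset.card_le_two
    omega
  · simp only [Finset.mem_sdiff, Finset.mem_image, Finset.mem_univ, true_and, Finset.mem_insert,
      Finset.mem_singleton, not_or] at ht
    obtain ⟨⟨i, rfl⟩, h0, h1⟩ := ht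
    exact ⟨⟨lt_of_le_of_ne (hXi i).1 (Ne.symm h0), lt_of_le_of_ne (hXi i).2 h1⟩, hzero i⟩

end

/-! ### Nodes, antinodes and the final count. -/

/-- By Fermat's theorem this makes an antinode of a differentiable `S` a double zero. -/
theorem IsAntinode.isLocalExtr {S : ℝ → ℝ} {c : ℝ} (h : IsAntinode S c) : IsLocalExtr S c := by
  obtain ⟨-, h0, hε⟩ := h
  obtain ⟨ε, ⟨hs, -⟩, hpos⟩ := (hε.and self_mem_nhdsWithin).exists
  have hpos : 0 < ε := hpos
  have hn : Ioo (c - ε) (c + ε) ∈ 𝓝 c := Ioo_mem_nhds (by linarith) (by linarith)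
  rcases hs with hs | hs
  · exact Or.inl (Filter.eventually_of_mem hn fun x hx => by rw [h0]; exact hs x hx)
  · exact Or.inr (Filter.eventually_of_mem hn fun x hx => by rw [h0]; exact hs x hx)

theorem IsNode.not_isAntinode {S : ℝ → ℝ} {c : ℝ} (h : IsNode S c) : ¬ IsAntinode S c := by
  intro h'
  obtain ⟨ε, ⟨⟨xm, hxm, xp, hxp, hlt⟩, hs, -⟩, hpos⟩ :=
    ((h.2.2.and h'.2.2).and self_mem_nhdsWithin).exists
  have hpos : 0 < ε := hpos
  have hm : xm ∈ Ioo (c - ε) (c + ε) := ⟨hxm.1, by linarith [hxm.2]⟩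
  have hp : xp ∈ Ioo (c - ε) (c + ε) := ⟨by linarith [hxp.1], hxp.2⟩
  rcases hs with hs | hs
  · exact hlt.not_ge (mul_nonneg (hs _ hm) (hs _ hp))
  · exact hlt.not_ge (mul_nonneg_of_nonpos_of_nonpos (hs _ hm) (hs _ hp))

/-- The coefficients `((ev j - μ) / (ev p - μ)) ^ k * b j` concentrate on the top index `p`. -/
theorem tendsto_ratio_pow_mul {ev : ℕ → ℝ} (hmono : StrictMono ev) {μ : ℝ} (hμ : μ < ev 0) {n : ℕ}
    {b : Fin n → ℝ} {p : Fin n} (hp : ∀ j, p < j → b j = 0) :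
    Tendsto (fun (k : ℕ) (j : Fin n) => ((ev j - μ) / (ev p - μ)) ^ k * b j) atTop
      (𝓝 (Pi.single p (b p))) := by
  have hpos : ∀ j : ℕ, 0 < ev j - μ := fun j => by
    linarith [hmono.monotone (Nat.zero_le j)]
  refine tendsto_pi_nhds.mpr fun j => ?_
  rcases lt_trichotomy j p with hj | rfl | hj
  · rw [Pi.single_eq_of_ne hj.ne]
    have hlt : (ev j - μ) / (ev p - μ) < 1 := by
      rw [div_lt_one (hpos p)]
      linarith [hmono (show (j : ℕ) < p from hj)]
    simpa using (tendsto_pow_atTop_nhds_zero_of_lt_one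
      (div_pos (hpos j) (hpos p)).le hlt).mul_const (b j)
  · simp [div_self (hpos j).ne']
  · rw [Pi.single_eq_of_ne hj.ne']
    simp [hp j hj]

/-- Zeros of a combination of the first `n` eigenfunctions, those at local extrema being counted
twice, number at most `n - 1`. -/
theorem card_zeros_add_card_extr_le {q : ℝ → ℝ} {B : ℝ} (hq : Continuous q)
    (hB : ∀ x, |q x| ≤ B) {ev : ℕ → ℝ} {h : ℕ → ℝ → ℝ} (hmono : StrictMono ev)
    (hev : ∀ μ, IsDirichletEigenvalue q μ → ∃ j, ev j = μ)
    (hh : ∀ j, IsDirichletEigenfunction q (ev j) (h j)) {n : ℕ} {b : Fin n → ℝ} (hb : b ≠ 0)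
    (s d : Finset ℝ) (hds : d ⊆ s) (hs : ∀ x ∈ s, x ∈ Ioo (0 : ℝ) 1 ∧ linComb h b x = 0)
    (hd : ∀ x ∈ d, IsLocalExtr (linComb h b) x) : s.card + d.card ≤ n - 1 := by
  classical
  choose Θ hΘ0 hΘ using fun μ => exists_isPruferAngle hq hB μ 0
  choose r hr0 hr hsol using fun μ => (hΘ μ).exists_amplitude hq
  choose C hC hhC using fun j => (hh j).exists_eq_const_mul hq hB (hsol (ev j))
    (by simp [hΘ0]) (by simp [hΘ0, hr0])
  set y : Fin n → ℝ → ℝ := fun j x => C j * (r (ev j) x * Real.sin (Θ (ev j) x)) with hy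
  set z : Fin n → ℝ → ℝ := fun j x => C j * (r (ev j) x * Real.cos (Θ (ev j) x)) with hz
  have hyh : ∀ j : Fin n, ∀ x ∈ Icc (0 : ℝ) 1, h j x = y j x := fun j x hx => hhC j x hx
  have hyz : ∀ j : Fin n, IsSolutionPair q (ev j) (y j) (z j) := fun j x hx =>
    ⟨(hsol _ x hx).1.const_mul _, ((hsol _ x hx).2.const_mul _).congr_deriv
      (by simp only [hy]; ring)⟩
  have hy0 : ∀ j, y j 0 = 0 := fun j => by
    rw [← hyh j 0 (by simp)]; exact (hh j).left_boundary
  have hy1 : ∀ j, y j 1 = 0 := fun j => by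
    rw [← hyh j 1 (by simp)]; exact (hh j).right_boundary
  have hS : ∀ x ∈ Icc (0 : ℝ) 1, linComb h b x = ∑ j, b j * y j x := fun x hx =>
    Finset.sum_congr rfl fun j _ => by rw [hyh j x hx]
  have hs' : ∀ x ∈ s, x ∈ Ioo (0 : ℝ) 1 ∧ ∑ j, b j * y j x = 0 := fun x hx =>
    ⟨(hs x hx).1, by rw [← hS x (Ioo_subset_Icc_self (hs x hx).1)]; exact (hs x hx).2⟩
  have hd' : ∀ x ∈ d, ∑ j, b j * z j x = 0 := by
    intro x hx
    have hx01 := (hs x (hds hx)).1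
    have heq : linComb h b =ᶠ[𝓝 x] fun x => ∑ j, b j * y j x :=
      Filter.eventually_of_mem (isOpen_Ioo.mem_nhds hx01) fun t ht => hS t (Ioo_subset_Icc_self ht)
    exact (hd x hx).hasDerivAt_eq_zero
      ((hasDerivAt_sum_const_mul hyz b (Ioo_subset_Icc_self hx01)).congr_of_eventuallyEq heq)
  -- The first bound makes every `ev j - μ` positive, the second puts `μ + 2` below `q`.
  set μ := min (ev 0 - 1) (-B - 2)
  have hμ0 : μ < ev 0 := by linarith [min_le_left (ev 0 - 1) (-B - 2)]
  have hμq : ∀ x, μ + 2 ≤ q x := fun x => by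
    linarith [min_le_right (ev 0 - 1) (-B - 2), neg_le_of_abs_le (hB x)]
  obtain ⟨V, W, hV, hVpos⟩ := exists_pos_solutionPair hq hB hμq
  obtain ⟨t, htc, ht⟩ := exists_finset_zeros_of_double_zeros hV hVpos hyz hy0 hy1 b s d hds hs' hd'
  obtain ⟨p, hbp, hpmax⟩ : ∃ p, b p ≠ 0 ∧ ∀ j, p < j → b j = 0 := by
    obtain ⟨i, hi⟩ := Function.ne_iff.mp hb
    obtain ⟨p, hp, hmax⟩ := (Finset.univ.filter fun j => b j ≠ 0).exists_max_image id
      ⟨i, by simpa using hi⟩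
    refine ⟨p, by simpa using hp, fun j hj => ?_⟩
    by_contra hne
    exact (hmax j (by simpa using hne)).not_gt hj
  have hposp : 0 < ev p - μ := by linarith [hmono.monotone (Nat.zero_le p)]
  -- Dividing by `(ev p - μ) ^ k` keeps the zeros and makes the coefficients converge. Zeros of the
  -- limit are simple since `sin` and `cos` never vanish together.
  obtain ⟨t', htc', ht'⟩ := exists_finset_zeros_of_tendsto hyz hy0 hy1 (N := t.card)
    (tendsto_ratio_pow_mul hmono hμ0 (b := fun j => (ev j - μ) * b j) (p := p)
      (fun j hj => by simp [hpmax j hj]))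
    (fun k => by
      obtain ⟨u, huc, hu⟩ := exists_finset_zeros_iterate hV hVpos hyz hy0 hy1 _ t ht k
      refine ⟨u, huc, fun x hx => ⟨(hu x hx).1, ?_⟩⟩
      calc _ = ((ev p - μ) ^ k)⁻¹ * ∑ j : Fin n, (ev j - μ) ^ k * ((ev j - μ) * b j) * y j x := by
            rw [Finset.mul_sum]
            refine Finset.sum_congr rfl fun j _ => ?_
            rw [div_pow]; ring
        _ = 0 := by rw [(hu x hx).2, mul_zero])
    (fun x _ hx hx' => by
      have hne : (ev p - μ) * b p ≠ 0 := mul_ne_zero hposp.ne' hbp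
      simp only [Pi.single_apply, ite_mul, zero_mul, Finset.sum_ite_eq', Finset.mem_univ,
        if_true, mul_eq_zero, hne, hy, hz, hC, (hr _ _).ne', false_or] at hx hx'
      have := Real.sin_sq_add_cos_sq (Θ (ev p) x)
      simp [hx, hx'] at this)
  have hle := card_zeros_le_of_isPruferAngle hq hB hmono hev hΘ0 hΘ p t' fun x hx => by
    refine ⟨(ht' x hx).1, ?_⟩
    have h2 := (ht' x hx).2
    simpa only [Pi.single_apply, ite_mul, zero_mul, Finset.sum_ite_eq', Finset.mem_univ,
      if_true, mul_eq_zero, hy, hC, (hr _ _).ne', false_or, hposp.ne', hbp] using h2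
  have := p.isLt
  omega

/-- A uniform bound over finite subsets forces finiteness, so finite counting suffices. -/
theorem encard_add_two_mul_encard_le {α : Type*} {s t : Set α} {m : ℕ}
    (h : ∀ u v : Finset α, (u : Set α) ⊆ s → (v : Set α) ⊆ t → u.card + 2 * v.card ≤ m) :
    s.encard + 2 * t.encard ≤ m := by
  have hfin : ∀ r : Set α, (∀ u : Finset α, (u : Set α) ⊆ r → u.card ≤ m) → r.Finite := by
    intro r hr
    by_contra hinf
    obtain ⟨u, hu, hc⟩ := Set.Infinite.exists_subset_card_eq hinf (m + 1)
    have := hr u hu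
    omega
  have hs := hfin s fun u hu => by simpa using h u ∅ hu (by simp)
  have ht := hfin t fun v hv => by
    have := h ∅ v (by simp) hv
    simp only [Finset.card_empty] at this
    omega
  rw [hs.encard_eq_coe_toFinset_card, ht.encard_eq_coe_toFinset_card]
  exact_mod_cast h hs.toFinset ht.toFinset (by simp) (by simp)

theorem propositionA2 (q : ℝ → ℝ) (U : Set ℝ) (hU : IsOpen U) (hIU : Icc (0 : ℝ) 1 ⊆ U)
    (hq : ContDiffOn ℝ ∞ q U) (ev : ℕ → ℝ) (h : ℕ → ℝ → ℝ) (hh : IsDirichletEigenpairs q ev h)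
    (n : ℕ) (hn : 1 ≤ n) (b : Fin n → ℝ) (hb : b ≠ 0) :
    {c : ℝ | IsNode (linComb h b) c}.encard + 2 * {c : ℝ | IsAntinode (linComb h b) c}.encard
      ≤ ((n - 1 : ℕ) : ℕ∞) := by
  classical
  -- Extending `q` from `[0,1]` by its endpoint values gives a bounded continuous potential on `ℝ`
  -- with the same eigenfunctions.
  set Q : ℝ → ℝ := IccExtend zero_le_one ((Icc (0 : ℝ) 1).domRestrict q) with hQ
  have hQc : Continuous Q :=
    (continuousOn_iff_continuous_domRestrict.mp (hq.continuousOn.mono hIU)).Icc_extend'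
  have hQq : ∀ x ∈ Icc (0 : ℝ) 1, Q x = q x := fun x hx => by
    rw [hQ, IccExtend_of_mem _ _ hx, domRestrict_apply]
  obtain ⟨B, hB⟩ := isCompact_Icc.exists_bound_of_continuousOn (hq.continuousOn.mono hIU)
  have hQB : ∀ x, |Q x| ≤ B := fun x => hB _ (projIcc (0 : ℝ) 1 zero_le_one x).2
  have hev : ∀ μ, IsDirichletEigenvalue Q μ → ∃ j, ev j = μ := fun μ ⟨y, hy⟩ =>
    (hh.eigenvalue_iff μ).mp ⟨y, hy.congr_potential fun x hx => (hQq x hx).symm⟩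
  refine encard_add_two_mul_encard_le fun u v hu hv => ?_
  have hdisj : Disjoint u v := Finset.disjoint_left.mpr fun x hxu hxv =>
    IsNode.not_isAntinode (hu hxu) (hv hxv)
  -- With zeros `u ∪ v` and double zeros `v`, the count is `u.card + 2 * v.card`.
  have key := card_zeros_add_card_extr_le hQc hQB hh.strictMono hev
    (fun j => (hh.eigenfunction j).congr_potential hQq) hb (u ∪ v) v Finset.subset_union_right
    (fun x hx => (Finset.mem_union.mp hx).elim (fun hx => ⟨(hu hx).1, (hu hx).2.1⟩)
      fun hx => ⟨(hv hx).1, (hv hx).2.1⟩)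
    fun x hx => (hv hx).isLocalExtr
  rw [Finset.card_union_of_disjoint hdisj] at key
  omega
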